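/- All groups are finite. Let $G$ be a group. A chief factor of $G$ is a quotient $K/L$ where $L<K$ are normal subgroups of $G$ and no normal subgroup of $G$ lies strictly between $L$ and $K$. The group $G$ is supersolvable if every chief factor of $G$ has prime order, and, for a prime $p$, it is $p$-supersolvable if every chief factor of $G$ has order $p$ or order prime to $p$. Let $\mathscr{U}$ and $\mathscr{U}_p$ denote the classes of supersolvable and of $p$-supersolvable groups. For a class $\mathscr{F}\in\{\mathscr{U},\mathscr{U}_p\}$, the residual $T^{\mathscr{F}}$ of a group $T$ is the intersection of all normal subgroups $N$ of $T$ with $T/N\in\mathscr{F}$, and the weak norm of a subgroup $H$ of $G$ with respect to $\mathscr{F}$ is $$N_{\mathscr{F}}(G,H)=\bigcap_{T\leq H}N_G(T^{\mathscr{F}}).$$ Let $\pi(H)$ be the set of prime divisors of $|H|$; an empty intersection of subgroups of $G$ is $G$. **Theorem.** Let $G$ be a finite solvable group and $H$ a normal subgroup of $G$. Then $$\bigcap_{p\in\pi(H)}N_{\mathscr{U}_p}(G,H)=G\quad\text{if and only if}\quad N_{\mathscr{U}}(G,H)=G.$$ -/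

import Mathlib

universe u

/-- `K / L` is a chief factor of the group `G`: `L < K` are normal subgroups of `G`, and no normal
subgroup of `G` lies strictly between them. -/
structure IsChiefFactor {G : Type u} [Group G] (L K : Subgroup G) : Prop where
  normal_bot : L.Normal
  normal_top : K.Normal
  lt : L < K
  eq_or_eq : ∀ N : Subgroup G, N.Normal → L ≤ N → N ≤ K → N = L ∨ N = K

/-- A finite group is supersolvable if each of its chief factors has prime order
(the order of `K / L` is `L.relIndex K`). -/
def IsSupersolvable (G : Type u) [Group G] : Prop :=
  ∀ L K : Subgroup G, IsChiefFactor L K → (L.relIndex K).Prime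

/-- A finite group is `p`-supersolvable if each of its chief factors has order `p` or order prime
to `p`. -/
def IsPSupersolvable (p : ℕ) (G : Type u) [Group G] : Prop :=
  ∀ L K : Subgroup G, IsChiefFactor L K → L.relIndex K = p ∨ (L.relIndex K).Coprime p

/-- The residual of `G` with respect to a class `F` of groups: the intersection of all normal
subgroups `N` of `G` such that `G / N` belongs to `F`. -/
def groupResidual (F : ∀ (X : Type u) [Group X], Prop) (G : Type u) [Group G] : Subgroup G :=
  sInf {N : Subgroup G | ∃ _ : N.Normal, F (G ⧸ N)}

/-- The weak norm of `H` in `G` with respect to `F`: the intersection, over all subgroups `T` of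
`H`, of the normalizers in `G` of the `F`-residual of `T` (viewed as a subgroup of `G`). -/
def weakNorm (F : ∀ (X : Type u) [Group X], Prop) {G : Type u} [Group G] (H : Subgroup G) :
    Subgroup G :=
  ⨅ (T : Subgroup G) (_ : T ≤ H),
    Subgroup.normalizer (((groupResidual F T).map T.subtype : Subgroup G) : Set G)

/-! A weak norm is all of G exactly when the residual of every T ≤ H is normal in G. A group is
supersolvable iff it is q-supersolvable for each prime q dividing its order, so the supersolvable
residual R of T is the join of its q-supersolvable residuals over q ∈ π(T); as π(T) ⊆ π(H), one
direction follows (`normal_residualIn_prime`). For the converse, normality of all the supersolvable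
residuals forces each of them to be nilpotent (`isNilpotent_residualIn`); this uses solvability.
Then the p-supersolvable residual of T is the Sylow p-subgroup of R, that is, its set of p-elements
(`mem_chiefResidual_iff`), and so is normal in G along with R. -/

open Subgroup

/-! ### Dedekind's law and the order of a product -/

section Dedekind

variable {G : Type*} [Group G]

theorem Subgroup.sup_inf_eq_of_le_of_normal {A K N : Subgroup G} [N.Normal] (h : A ≤ K) :
    (A ⊔ N) ⊓ K = A ⊔ N ⊓ K := by
  refine le_antisymm ?_ (le_inf (sup_le_sup_left inf_le_left _) (sup_le h inf_le_right))
  rintro x ⟨hx, hxK⟩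
  obtain ⟨a, ha, n, hn, rfl⟩ := mem_sup_of_normal_right.mp hx
  exact mul_mem_sup ha ⟨hn, (K.mul_mem_cancel_left (h ha)).mp hxK⟩

theorem Subgroup.card_sup_dvd_of_normal (A B : Subgroup G) [B.Normal] :
    Nat.card (A ⊔ B : Subgroup G) ∣ Nat.card A * Nat.card B := by
  rw [← relIndex_bot_left, ← relIndex_mul_relIndex ⊥ B (A ⊔ B) bot_le le_sup_right,
    relIndex_sup_right, relIndex_bot_left, mul_comm]
  exact mul_dvd_mul_right (relIndex_dvd_card B A) _

end Dedekind

/-! ### Transfer of chief factors -/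

section ChiefFactor

variable {G G' : Type u} [Group G] [Group G'] {L K N : Subgroup G}

/-- Together with `IsChiefFactor.inf` this is a dichotomy: relative to N, each chief factor moves
above N or inside N without change of order. -/
theorem IsChiefFactor.sup (h : IsChiefFactor L K) [N.Normal] (hN : N ⊓ K ≤ L) :
    IsChiefFactor (L ⊔ N) (K ⊔ N) ∧ (L ⊔ N).relIndex (K ⊔ N) = L.relIndex K := by
  have := h.normal_bot
  have := h.normal_top
  have hinf : (L ⊔ N) ⊓ K = L := by
    rw [sup_inf_eq_of_le_of_normal h.lt.le, sup_eq_left.mpr hN]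
  refine ⟨⟨inferInstance, inferInstance, ?_, fun J hJ hLJ hJK => ?_⟩, ?_⟩
  · refine lt_of_le_of_ne (sup_le_sup_right h.lt.le _) fun he => h.lt.ne ?_
    rw [← hinf, he, inf_eq_right.mpr le_sup_left]
  · rcases h.eq_or_eq (J ⊓ K) inferInstance (le_inf (le_sup_left.trans hLJ) h.lt.le) inf_le_right
      with h1 | h1
    · left
      refine le_antisymm ?_ hLJ
      calc J = (N ⊔ K) ⊓ J := by rw [sup_comm, inf_eq_right.mpr hJK]
        _ = N ⊔ K ⊓ J := sup_inf_eq_of_le_of_normal (le_sup_right.trans hLJ)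
        _ ≤ L ⊔ N := by rw [inf_comm, h1, sup_comm]
    · right
      exact le_antisymm hJK (sup_le (inf_eq_right.mp h1) (le_sup_right.trans hLJ))
  · have : K ⊔ N = K ⊔ (L ⊔ N) := by rw [← sup_assoc, sup_eq_left.mpr h.lt.le]
    rw [this, relIndex_sup_right, ← inf_relIndex_right, hinf]

theorem IsChiefFactor.inf (h : IsChiefFactor L K) [N.Normal] (hN : ¬ N ⊓ K ≤ L) :
    IsChiefFactor (N ⊓ L) (N ⊓ K) ∧ (N ⊓ L).relIndex (N ⊓ K) = L.relIndex K := by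
  have := h.normal_bot
  have := h.normal_top
  have hsup : N ⊓ K ⊔ L = K := by
    rcases h.eq_or_eq (N ⊓ K ⊔ L) inferInstance le_sup_right (sup_le inf_le_right h.lt.le)
      with h1 | h1
    · exact absurd (sup_eq_right.mp h1) hN
    · exact h1
  refine ⟨⟨inferInstance, inferInstance, ?_, fun J hJ hLJ hJK => ?_⟩, ?_⟩
  · refine lt_of_le_of_ne (inf_le_inf_left _ h.lt.le) fun he => hN ?_
    rw [← he]; exact inf_le_right
  · rcases h.eq_or_eq (J ⊔ L) inferInstance le_sup_right
      (sup_le (hJK.trans inf_le_right) h.lt.le) with h1 | h1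
    · left
      exact le_antisymm (le_inf (hJK.trans inf_le_left) (sup_eq_right.mp h1)) hLJ
    · right
      refine le_antisymm hJK ?_
      calc N ⊓ K = (J ⊔ L) ⊓ N := by rw [h1, inf_comm]
        _ = J ⊔ L ⊓ N := sup_inf_eq_of_le_of_normal (hJK.trans inf_le_left)
        _ ≤ J := sup_le le_rfl (by rw [inf_comm]; exact hLJ)
  · have : (N ⊓ L).relIndex (N ⊓ K) = L.relIndex (N ⊓ K) := by
      rw [← inf_relIndex_right, ← inf_relIndex_right L]
      congr 1
      exact le_antisymm (le_inf (inf_le_left.trans inf_le_right) inf_le_right)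
        (le_inf (le_inf (inf_le_right.trans inf_le_left) inf_le_left) inf_le_right)
    rw [this, ← relIndex_sup_right, hsup]

theorem IsChiefFactor.comap {f : G →* G'} (hf : Function.Surjective f) {L K : Subgroup G'}
    (h : IsChiefFactor L K) : IsChiefFactor (L.comap f) (K.comap f) := by
  have := h.normal_bot
  have := h.normal_top
  refine ⟨inferInstance, inferInstance, (comap_lt_comap_of_surjective hf).mpr h.lt,
    fun J hJ hLJ hJK => ?_⟩
  have hJ' : (J.map f).comap f = J :=
    comap_map_eq_self ((ker_le_comap f L).trans hLJ)
  rw [← hJ'] at hLJ hJK ⊢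
  rw [comap_le_comap_of_surjective hf] at hLJ hJK
  rcases h.eq_or_eq (J.map f) (hJ.map f hf) hLJ hJK with h1 | h1 <;> simp [h1]

theorem IsChiefFactor.map {f : G →* G'} (hf : Function.Surjective f) (hL : f.ker ≤ L)
    (h : IsChiefFactor L K) : IsChiefFactor (L.map f) (K.map f) := by
  have hL' : (L.map f).comap f = L := comap_map_eq_self hL
  have hK' : (K.map f).comap f = K := comap_map_eq_self (hL.trans h.lt.le)
  refine ⟨h.normal_bot.map f hf, h.normal_top.map f hf, ?_, fun J hJ hLJ hJK => ?_⟩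
  · rw [← comap_lt_comap_of_surjective hf, hL', hK']
    exact h.lt
  · rw [← comap_le_comap_of_surjective hf, hL'] at hLJ
    rw [← comap_le_comap_of_surjective hf, hK'] at hJK
    rw [← (comap_injective hf).eq_iff, hL', ← (comap_injective hf).eq_iff, hK']
    exact h.eq_or_eq _ (hJ.comap f) hLJ hJK

/-- Every chief factor of the group has order satisfying `P`. -/
def ChiefOrders (P : ℕ → Prop) (G : Type u) [Group G] : Prop :=
  ∀ L K : Subgroup G, IsChiefFactor L K → P (L.relIndex K)

/-- Every chief factor of the group above `N` has order satisfying `P`. -/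
def ChiefOrdersAbove (P : ℕ → Prop) (N : Subgroup G) : Prop :=
  ∀ L K : Subgroup G, IsChiefFactor L K → N ≤ L → P (L.relIndex K)

variable {P Q : ℕ → Prop}

theorem ChiefOrdersAbove.mono {M : Subgroup G} (h : ChiefOrdersAbove P N) (hNM : N ≤ M) :
    ChiefOrdersAbove P M :=
  fun L K hLK hL => h L K hLK (hNM.trans hL)

theorem ChiefOrdersAbove.imp (hPQ : ∀ n, P n → Q n) (h : ChiefOrdersAbove P N) :
    ChiefOrdersAbove Q N :=
  fun L K hLK hL => hPQ _ (h L K hLK hL)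

/-- A factor above N ⊓ M either moves above N, or moves inside N and from there above M. -/
theorem ChiefOrdersAbove.inf {M : Subgroup G} [N.Normal] [M.Normal] (hN : ChiefOrdersAbove P N)
    (hM : ChiefOrdersAbove P M) : ChiefOrdersAbove P (N ⊓ M) := by
  intro L K h hL
  by_cases hK : N ⊓ K ≤ L
  · obtain ⟨h1, h2⟩ := h.sup hK
    exact h2 ▸ hN _ _ h1 le_sup_right
  · obtain ⟨h1, h2⟩ := h.inf hK
    have hM' : M ⊓ (N ⊓ K) ≤ N ⊓ L :=
      le_inf (inf_le_right.trans inf_le_left)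
        ((le_inf (inf_le_right.trans inf_le_left) inf_le_left).trans hL)
    obtain ⟨h3, h4⟩ := h1.sup hM'
    exact h2 ▸ h4 ▸ hM _ _ h3 le_sup_right

theorem chiefOrdersAbove_comap_iff {f : G →* G'} (hf : Function.Surjective f) (N : Subgroup G') :
    ChiefOrdersAbove P (N.comap f) ↔ ChiefOrdersAbove P N := by
  constructor
  · intro h L K hLK hL
    have := h _ _ (hLK.comap hf) (comap_mono hL)
    rwa [relIndex_comap, map_comap_eq_self_of_surjective hf] at this
  · intro h L K hLK hL
    have hker : f.ker ≤ L := (ker_le_comap f N).trans hL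
    have := h _ _ (hLK.map hf hker) (by
      rw [← comap_le_comap_of_surjective hf, comap_map_eq_self hker]; exact hL)
    rwa [← relIndex_comap, comap_map_eq_self hker] at this

theorem chiefOrders_quotient_iff [N.Normal] :
    ChiefOrders P (G ⧸ N) ↔ ChiefOrdersAbove P N := by
  have h := chiefOrdersAbove_comap_iff (P := P) (QuotientGroup.mk'_surjective N) ⊥
  rw [MonoidHom.comap_bot, QuotientGroup.ker_mk'] at h
  rw [h]
  simp [ChiefOrders, ChiefOrdersAbove]

theorem chiefOrdersAbove_top : ChiefOrdersAbove P (⊤ : Subgroup G) :=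
  fun _ _ h hL => absurd (h.lt.trans_le le_top) hL.not_gt

end ChiefFactor

/-! ### Residuals and their functoriality -/

section Residual

/-- The smallest normal subgroup whose quotient has all its chief factor orders satisfying `P`. -/
def chiefResidual (P : ℕ → Prop) (G : Type u) [Group G] : Subgroup G :=
  groupResidual (fun (X : Type u) [Group X] => ChiefOrders P X) G

variable {P Q : ℕ → Prop} {G G' : Type u} [Group G] [Group G']

theorem chiefResidual_eq_sInf :
    chiefResidual P G = sInf {N : Subgroup G | N.Normal ∧ ChiefOrdersAbove P N} := by
  unfold chiefResidual groupResidual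
  congr 1
  ext N
  exact ⟨fun ⟨hN, h⟩ => ⟨hN, chiefOrders_quotient_iff.mp h⟩,
    fun ⟨hN, h⟩ => ⟨hN, chiefOrders_quotient_iff.mpr h⟩⟩

theorem chiefResidual_le {N : Subgroup G} [hN : N.Normal] (h : ChiefOrdersAbove P N) :
    chiefResidual P G ≤ N := by
  rw [chiefResidual_eq_sInf]
  exact sInf_le ⟨hN, h⟩

/-- By closure under intersection, a minimal admissible subgroup is the least one. -/
theorem chiefResidual_spec [Finite G] :
    (chiefResidual P G).Normal ∧ ChiefOrdersAbove P (chiefResidual P G) := by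
  obtain ⟨N, ⟨hN, hP⟩, hmin⟩ := Set.Finite.exists_minimal
    (Set.toFinite {N : Subgroup G | N.Normal ∧ ChiefOrdersAbove P N})
    ⟨⊤, inferInstance, chiefOrdersAbove_top⟩
  have : chiefResidual P G = N := by
    refine le_antisymm (chiefResidual_le hP) ?_
    rw [chiefResidual_eq_sInf]
    refine le_sInf fun M ⟨hM, hMP⟩ => ?_
    exact (hmin ⟨inferInstance, hP.inf hMP⟩ inf_le_left).trans inf_le_right
  rw [this]
  exact ⟨hN, hP⟩

instance chiefResidual_normal [Finite G] : (chiefResidual P G).Normal := chiefResidual_spec.1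

theorem chiefOrdersAbove_chiefResidual [Finite G] : ChiefOrdersAbove P (chiefResidual P G) :=
  chiefResidual_spec.2

theorem chiefResidual_mono [Finite G] (hPQ : ∀ n, P n → Q n) :
    chiefResidual Q G ≤ chiefResidual P G :=
  chiefResidual_le (chiefOrdersAbove_chiefResidual.imp hPQ)

theorem map_chiefResidual_le [Finite G'] {f : G →* G'} (hf : Function.Surjective f) :
    (chiefResidual P G).map f ≤ chiefResidual P G' := by
  rw [map_le_iff_le_comap]
  exact chiefResidual_le ((chiefOrdersAbove_comap_iff hf _).mpr chiefOrdersAbove_chiefResidual)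

theorem map_chiefResidual_equiv [Finite G] [Finite G'] (e : G ≃* G') :
    (chiefResidual P G).map e.toMonoidHom = chiefResidual P G' := by
  refine le_antisymm (map_chiefResidual_le e.surjective) fun x hx => ?_
  have := map_chiefResidual_le (P := P) (f := e.symm.toMonoidHom) e.symm.surjective
    (mem_map_of_mem _ hx)
  exact ⟨_, this, by simp⟩

/-- The residual of a subgroup, as a subgroup of the whole group. -/
def residualIn (P : ℕ → Prop) (T : Subgroup G) : Subgroup G :=
  (chiefResidual P T).map T.subtype

theorem residualIn_map_subtype [Finite G] {T : Subgroup G} (X : Subgroup T) :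
    residualIn P (X.map T.subtype) = (residualIn P X).map T.subtype := by
  unfold residualIn
  rw [← map_chiefResidual_equiv (X.equivMapOfInjective T.subtype T.subtype_injective),
    map_map, map_map]
  rfl

/-- G / F is an image of X by a map that kills the residual of X. -/
theorem chiefResidual_le_of_sup_eq_top [Finite G] {X F : Subgroup G} [F.Normal] (hXF : X ⊔ F = ⊤)
    (h : residualIn P X ≤ F) : chiefResidual P G ≤ F := by
  apply chiefResidual_le
  set f : X →* G ⧸ F := (QuotientGroup.mk' F).comp X.subtype
  have hf : Function.Surjective f := by
    intro y
    obtain ⟨g, rfl⟩ := QuotientGroup.mk_surjective y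
    obtain ⟨x, hx, n, hn, rfl⟩ := mem_sup_of_normal_right.mp (hXF ▸ mem_top g : g ∈ X ⊔ F)
    exact ⟨⟨x, hx⟩, QuotientGroup.eq.mpr (by simpa using hn)⟩
  have hle : chiefResidual P X ≤ (⊥ : Subgroup (G ⧸ F)).comap f := by
    intro x hx
    have : (x : G) ∈ F := h (mem_map_of_mem _ hx)
    simpa [f, mem_comap] using this
  have h1 := (chiefOrdersAbove_comap_iff hf ⊥).mp (chiefOrdersAbove_chiefResidual.mono hle)
  rwa [← chiefOrdersAbove_comap_iff (QuotientGroup.mk'_surjective F), MonoidHom.comap_bot,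
    QuotientGroup.ker_mk'] at h1

end Residual

/-! ### Nilpotent normal subgroups and supplements -/

section Fitting

variable {G : Type*} [Group G] [Finite G]

theorem Subgroup.isNilpotent_iff_exists_normal_pSubgroup {N : Subgroup G} [N.Normal] :
    Group.IsNilpotent N ↔ ∀ p : ℕ, p.Prime →
      ∃ P : Subgroup G, P.Normal ∧ P ≤ N ∧ IsPGroup p P ∧ ¬ p ∣ P.relIndex N := by
  constructor
  · intro h p hp
    have : Fact p.Prime := ⟨hp⟩
    let P : Sylow p N := default
    have hP : (P : Subgroup N).Normal := inferInstance
    have := P.characteristic_of_normal hP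
    refine ⟨(P : Subgroup N).map N.subtype, inferInstance, map_subtype_le _,
      P.isPGroup'.map _, ?_⟩
    rw [relIndex, subgroupOf, comap_map_eq_self_of_injective N.subtype_injective]
    exact P.not_dvd_index
  · intro h
    refine ((Group.isNilpotent_of_finite_tfae (G := N)).out 0 3).mpr ?_
    intro p hp Q
    obtain ⟨P, hPn, hPN, hP, hi⟩ := h p hp.out
    have hP' : IsPGroup p (P.subgroupOf N) := hP.comap_subtype
    have : (Q : Subgroup N) = P.subgroupOf N :=
      (hP'.toSylow hi).is_maximal' Q.isPGroup' (hP'.le_sylow_of_normal Q)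
    rw [this]
    infer_instance

/-- **Fitting's theorem** for finite groups. -/
theorem Subgroup.isNilpotent_sup_of_normal {A B : Subgroup G} [A.Normal] [B.Normal]
    (hA : Group.IsNilpotent A) (hB : Group.IsNilpotent B) :
    Group.IsNilpotent (A ⊔ B : Subgroup G) := by
  rw [isNilpotent_iff_exists_normal_pSubgroup] at hA hB ⊢
  intro p hp
  obtain ⟨P, hPn, hPA, hP, hPi⟩ := hA p hp
  obtain ⟨Q, hQn, hQB, hQ, hQi⟩ := hB p hp
  refine ⟨P ⊔ Q, inferInstance, sup_le_sup hPA hQB, hP.to_sup_of_normal_right hQ, ?_⟩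
  -- |AB : PQ| = |AB : PB| |PB : PQ|, and the factors divide |A : P| and |B : Q|.
  rw [← relIndex_mul_relIndex (P ⊔ Q) (P ⊔ B) (A ⊔ B) (sup_le_sup_left hQB _)
    (sup_le_sup_right hPA _), hp.dvd_mul, not_or]
  constructor
  · rw [show P ⊔ B = B ⊔ (P ⊔ Q) by rw [sup_left_comm, sup_comm B, sup_eq_right.mpr hQB],
      relIndex_sup_right]
    exact fun h => hQi (h.trans (relIndex_dvd_of_le_left _ le_sup_right))
  · rw [show A ⊔ B = A ⊔ (P ⊔ B) by rw [← sup_assoc, sup_eq_left.mpr hPA], relIndex_sup_right]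
    exact fun h => hPi (h.trans (relIndex_dvd_of_le_left _ le_sup_left))

/-- A maximal normal nilpotent subgroup of a finite solvable group is either the whole group, or
it has a proper supplement. -/
theorem Subgroup.exists_supplement_of_maximal_nilpotent [Group.IsSolvable G] {F : Subgroup G}
    [F.Normal]
    (hmax : ∀ N : Subgroup G, N.Normal → Group.IsNilpotent N → F ≤ N → N = F) (hne : F ≠ ⊤) :
    ∃ X : Subgroup G, X ≠ ⊤ ∧ X ⊔ F = ⊤ := by
  -- M / F is the last nontrivial derived term of G / F, hence abelian.
  obtain ⟨M, hM, hFM, hMc⟩ : ∃ M : Subgroup G, M.Normal ∧ F < M ∧ ⁅M, M⁆ ≤ F := by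
    have hs : ∃ n, derivedSeries G n ≤ F := by
      obtain ⟨n, hn⟩ := (Group.isSolvable_def G).mp ‹_›
      exact ⟨n, hn ▸ bot_le⟩
    classical
    obtain ⟨k, hk⟩ : ∃ k, Nat.find hs = k + 1 := by
      refine Nat.exists_eq_succ_of_ne_zero fun h0 => hne ?_
      simpa [h0] using Nat.find_spec hs
    have h1 : ¬ derivedSeries G k ≤ F := Nat.find_min hs (by omega)
    have h2 : ⁅derivedSeries G k, derivedSeries G k⁆ ≤ F := by
      have := Nat.find_spec hs
      rwa [hk, derivedSeries_succ] at this
    refine ⟨derivedSeries G k ⊔ F, inferInstance, lt_of_le_of_ne le_sup_right ?_, ?_⟩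
    · exact fun h => h1 (sup_eq_right.mp h.symm)
    · rw [← QuotientGroup.ker_mk' F, ← map_eq_bot_iff] at h2 ⊢
      rwa [map_commutator, map_sup, (map_eq_bot_iff (QuotientGroup.mk' F).ker).mpr le_rfl,
        sup_bot_eq, ← map_commutator]
  have hMn : ¬ Group.IsNilpotent M := fun h => hFM.ne (hmax M hM h hFM.le).symm
  have := (Group.isNilpotent_of_finite_tfae (G := M)).out 0 3
  rw [this] at hMn
  push Not at hMn
  obtain ⟨p, hp, P, hP⟩ := hMn
  set P' : Subgroup G := (P : Subgroup M).map M.subtype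
  -- The supplement is the normalizer of a non-normal Sylow subgroup P of M. Frattini gives G =
  -- N(P)M; since PF ⊇ [M, M] is normal in M, Frattini again gives M = N_M(P)F.
  refine ⟨normalizer (P' : Set G), fun h => hP ?_, ?_⟩
  · exact (normalizer_eq_top_iff.mp h).of_map_subtype
  · have hFr := Sylow.normalizer_sup_eq_top P
    rw [eq_top_iff, ← hFr]
    refine sup_le le_sup_left ?_
    set F' : Subgroup M := F.subgroupOf M
    have hn : ((P : Subgroup M) ⊔ F').Normal := by
      rw [← commutator_top_left_le_iff]
      refine (commutator_mono le_rfl le_top).trans (le_trans ?_ le_sup_right)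
      refine map_le_iff_le_comap.mp ?_
      rwa [map_commutator, ← MonoidHom.range_eq_map, range_subtype]
    have hM' : normalizer ((P : Subgroup M) : Set M) ⊔ ((P : Subgroup M) ⊔ F') = ⊤ :=
      Sylow.normalizer_sup_eq_top' P le_sup_left
    rw [← sup_assoc, sup_eq_left.mpr le_normalizer] at hM'
    calc M = (⊤ : Subgroup M).map M.subtype := by rw [← MonoidHom.range_eq_map, range_subtype]
      _ ≤ _ := by
        rw [← hM', map_sup]
        exact sup_le_sup (le_normalizer_map _) (map_subgroupOf_eq_of_le hFM.le).le

end Fitting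

/-! ### Nilpotency and Sylow structure of the supersolvable residual -/

section SupersolvableResidual

theorem Nat.Prime.eq_or_coprime {n p : ℕ} (hp : p.Prime) (hn : n.Prime) :
    n = p ∨ n.Coprime p := by
  rw [Nat.coprime_primes hn hp]; exact em _

theorem prime_of_forall_eq_or_coprime {n : ℕ} (hn : n ≠ 1)
    (h : ∀ q : ℕ, q.Prime → q ∣ n → n = q ∨ n.Coprime q) : n.Prime := by
  obtain ⟨q, hq, hqn⟩ := Nat.exists_prime_and_dvd hn
  rcases h q hq hqn with rfl | hc
  · exact hq
  · exact absurd hqn ((Nat.Prime.coprime_iff_not_dvd hq).mp hc.symm)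

variable {G : Type u} [Group G]

theorem Subgroup.not_dvd_card_biSup {ι : Type*} {p : ℕ} (hp : p.Prime) (s : Finset ι)
    (R : ι → Subgroup G) [∀ i, (R i).Normal] (h : ∀ i ∈ s, ¬ p ∣ Nat.card (R i)) :
    ¬ p ∣ Nat.card (⨆ i ∈ s, R i : Subgroup G) := by
  classical
  induction s using Finset.induction_on with
  | empty => simpa using hp.one_lt.ne'
  | insert a s ha ih =>
    rw [Finset.iSup_insert]
    intro hd
    rcases hp.dvd_mul.mp (hd.trans (card_sup_dvd_of_normal _ _)) with h1 | h1
    · exact h a (Finset.mem_insert_self a s) h1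
    · exact ih (fun i hi => h i (Finset.mem_insert_of_mem hi)) h1

theorem Subgroup.isNilpotent_of_le {A B : Subgroup G} (hAB : A ≤ B) (hB : Group.IsNilpotent B) :
    Group.IsNilpotent A :=
  Group.nilpotent_of_mulEquiv (subgroupOfEquivOfLe hAB)

theorem weakNorm_eq_top_iff {P : ℕ → Prop} {H : Subgroup G} :
    weakNorm (fun (X : Type u) [Group X] => ChiefOrders P X) H = ⊤ ↔
      ∀ T ≤ H, (residualIn P T).Normal := by
  simp only [weakNorm, iInf_eq_top, normalizer_eq_top_iff]
  rfl

variable [Finite G]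

/-- The Fitting subgroup F, if proper, has a proper supplement X. The residual of X is normal and
nilpotent, so it lies in F, and then so does that of G. -/
theorem isNilpotent_chiefResidual_of_forall_lt [Group.IsSolvable G] {P : ℕ → Prop}
    (h : ∀ X : Subgroup G, X ≠ ⊤ → (residualIn P X).Normal ∧ Group.IsNilpotent (residualIn P X)) :
    Group.IsNilpotent (chiefResidual P G) := by
  obtain ⟨F, ⟨hFn, hF⟩, hmax⟩ := Set.Finite.exists_maximal
    (Set.toFinite {N : Subgroup G | N.Normal ∧ Group.IsNilpotent N})
    ⟨⊥, inferInstance, inferInstance⟩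
  refine isNilpotent_of_le ?_ hF
  by_cases hne : F = ⊤
  · exact hne ▸ le_top
  obtain ⟨X, hX, hXF⟩ := exists_supplement_of_maximal_nilpotent
    (fun N hN hNn hle => le_antisymm (hmax ⟨hN, hNn⟩ hle) hle) hne
  obtain ⟨hn, hnil⟩ := h X hX
  refine chiefResidual_le_of_sup_eq_top hXF ?_
  exact le_sup_right.trans
    (hmax ⟨inferInstance, isNilpotent_sup_of_normal hF hnil⟩ le_sup_left)

theorem isNilpotent_residualIn [Group.IsSolvable G] {P : ℕ → Prop} {H : Subgroup G}
    (h : ∀ T ≤ H, (residualIn P T).Normal) {T : Subgroup G} (hT : T ≤ H) :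
    Group.IsNilpotent (residualIn P T) := by
  induction T using WellFoundedLT.induction with
  | ind T ih =>
    have hnil : Group.IsNilpotent (chiefResidual P T) := by
      refine isNilpotent_chiefResidual_of_forall_lt fun X hX => ?_
      have hlt : X.map T.subtype < T := by
        refine lt_of_le_of_ne (map_subtype_le X) fun he => hX ?_
        rw [← map_injective T.subtype_injective |>.eq_iff, he, ← MonoidHom.range_eq_map,
          range_subtype]
      have h1 := h _ (hlt.le.trans hT)
      have h2 := ih _ hlt (hlt.le.trans hT)
      rw [residualIn_map_subtype] at h1 h2
      exact ⟨h1.of_map_subtype, Group.nilpotent_of_mulEquiv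
        ((residualIn P X).equivMapOfInjective T.subtype T.subtype_injective).symm⟩
    exact Group.nilpotent_of_mulEquiv
      ((chiefResidual P T).equivMapOfInjective T.subtype T.subtype_injective)

theorem chiefResidual_prime_le_of_forall {N : Subgroup G} [N.Normal]
    (h : ∀ q ∈ (Nat.card G).primeFactors, chiefResidual (fun n => n = q ∨ n.Coprime q) G ≤ N) :
    chiefResidual Nat.Prime G ≤ N := by
  refine chiefResidual_le fun L K hLK hL => prime_of_forall_eq_or_coprime ?_ fun _ hq hqn => ?_
  · rw [Ne, relIndex_eq_one]
    exact hLK.lt.not_ge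
  · have hdvd : _ ∣ Nat.card G :=
      hqn.trans ((relIndex_dvd_card L K).trans (card_subgroup_dvd_card K))
    exact chiefOrdersAbove_chiefResidual L K hLK
      ((h _ (Nat.mem_primeFactors.mpr ⟨hq, hdvd, Nat.card_pos.ne'⟩)).trans hL)

theorem chiefResidual_le_chiefResidual_prime {p : ℕ} (hp : p.Prime) :
    chiefResidual (fun n => n = p ∨ n.Coprime p) G ≤ chiefResidual Nat.Prime G :=
  chiefResidual_mono fun _ hn => hp.eq_or_coprime hn

theorem chiefResidual_prime_eq_iSup :
    chiefResidual Nat.Prime G = ⨆ q ∈ (Nat.card G).primeFactors,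
      chiefResidual (fun n => n = q ∨ n.Coprime q) G :=
  le_antisymm (chiefResidual_prime_le_of_forall fun _ hq => le_biSup
      (fun q => chiefResidual (fun n => n = q ∨ n.Coprime q) G) hq)
    (iSup₂_le fun _ hq => chiefResidual_le_chiefResidual_prime (Nat.prime_of_mem_primeFactors hq))

theorem isPGroup_chiefResidual (hnil : Group.IsNilpotent (chiefResidual Nat.Prime G)) {p : ℕ}
    (hp : p.Prime) : IsPGroup p (chiefResidual (fun n => n = p ∨ n.Coprime p) G) := by
  obtain ⟨Q, hQn, hQ, hQp, hQi⟩ := isNilpotent_iff_exists_normal_pSubgroup.mp hnil p hp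
  -- Q is the Sylow p-subgroup of the supersolvable residual. A chief factor above Q moves above
  -- that residual, where its order is prime, or inside it, where its order divides a p'-index.
  refine hQp.to_le (chiefResidual_le fun L K hLK hL => ?_)
  by_cases hK : chiefResidual Nat.Prime G ⊓ K ≤ L
  · obtain ⟨h1, h2⟩ := hLK.sup hK
    rw [← h2]
    exact hp.eq_or_coprime (chiefOrdersAbove_chiefResidual _ _ h1 le_sup_right)
  · obtain ⟨h1, h2⟩ := hLK.inf hK
    have := hLK.normal_bot
    rw [← h2]
    right
    refine ((Nat.Prime.coprime_iff_not_dvd hp).mpr fun hd => hQi ?_).symm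
    rw [← relIndex_mul_relIndex Q _ _ (le_inf hQ hL) inf_le_left,
      ← relIndex_mul_relIndex _ _ _ h1.lt.le inf_le_left]
    exact (hd.mul_right _).mul_left _

theorem mem_chiefResidual_iff (hnil : Group.IsNilpotent (chiefResidual Nat.Prime G)) {p : ℕ}
    (hp : p.Prime) {x : G} :
    x ∈ chiefResidual (fun n => n = p ∨ n.Coprime p) G ↔
      x ∈ chiefResidual Nat.Prime G ∧ ∃ k, x ^ p ^ k = 1 := by
  have hR := isPGroup_chiefResidual hnil hp
  constructor
  · refine fun hx => ⟨chiefResidual_le_chiefResidual_prime hp hx, ?_⟩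
    obtain ⟨k, hk⟩ := hR ⟨x, hx⟩
    exact ⟨k, congrArg Subtype.val hk⟩
  · rintro ⟨hx, k, hk⟩
    set R : ℕ → Subgroup G := fun q => chiefResidual (fun n => n = q ∨ n.Coprime q) G
    have : ∀ q, (R q).Normal := fun q => chiefResidual_normal
    -- C is a p'-group and C ⊔ R p contains x, so the index of R p ∩ ⟨x⟩ in ⟨x⟩ divides both |C| and
    -- a power of p.
    set C : Subgroup G := ⨆ q ∈ (Nat.card G).primeFactors.erase p, R q
    have hC : ¬ p ∣ Nat.card C := by
      refine not_dvd_card_biSup hp _ R fun q hq hd => ?_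
      have hq' := Nat.prime_of_mem_primeFactors (Finset.mem_of_mem_erase hq)
      have : Fact q.Prime := ⟨hq'⟩
      obtain ⟨n, hn⟩ := (isPGroup_chiefResidual hnil hq').exists_card_eq
      rw [hn] at hd
      exact Finset.ne_of_mem_erase hq
        ((Nat.prime_dvd_prime_iff_eq hp hq').mp (hp.dvd_of_dvd_pow hd)).symm
    have hle : chiefResidual Nat.Prime G ≤ C ⊔ R p := by
      refine chiefResidual_prime_le_of_forall fun q hq => ?_
      by_cases hqp : q = p
      · subst hqp; exact le_sup_right
      · exact (le_biSup R (Finset.mem_erase.mpr ⟨hqp, hq⟩)).trans le_sup_left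
    have h1 : (R p).relIndex (zpowers x) ∣ p ^ k :=
      (relIndex_dvd_card _ _).trans (by
        rw [Nat.card_zpowers]; exact orderOf_dvd_of_pow_eq_one hk)
    have h2 : (R p).relIndex (zpowers x) ∣ Nat.card C := by
      have hx' : zpowers x ⊔ R p ≤ C ⊔ R p :=
        sup_le ((zpowers_le.mpr hx).trans hle) le_sup_right
      rw [← relIndex_sup_right]
      refine dvd_trans ?_ (relIndex_dvd_card (R p) C)
      rw [← relIndex_sup_right (K := R p) (H := C),
        ← relIndex_mul_relIndex (R p) _ _ le_sup_right hx']
      exact dvd_mul_right _ _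
    have h3 : (R p).relIndex (zpowers x) = 1 :=
      Nat.eq_one_of_dvd_coprimes
        (((Nat.Prime.coprime_iff_not_dvd hp).mpr hC).pow_left k) h1 h2
    exact relIndex_eq_one.mp h3 (mem_zpowers x)

theorem normal_residualIn_of_prime {T : Subgroup G}
    (hnil : Group.IsNilpotent (residualIn Nat.Prime T)) (hn : (residualIn Nat.Prime T).Normal)
    {p : ℕ} (hp : p.Prime) : (residualIn (fun n => n = p ∨ n.Coprime p) T).Normal := by
  rw [residualIn] at hnil
  have hnil' : Group.IsNilpotent (chiefResidual Nat.Prime T) := Group.nilpotent_of_mulEquiv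
    ((chiefResidual Nat.Prime T).equivMapOfInjective T.subtype T.subtype_injective).symm
  have hmem : ∀ x : G, x ∈ residualIn (fun n => n = p ∨ n.Coprime p) T ↔
      x ∈ residualIn Nat.Prime T ∧ ∃ k, x ^ p ^ k = 1 := by
    intro x
    simp only [residualIn, mem_map, mem_chiefResidual_iff hnil' hp]
    constructor
    · rintro ⟨y, ⟨hy, k, hk⟩, rfl⟩
      exact ⟨⟨y, hy, rfl⟩, k, by simpa using congrArg T.subtype hk⟩
    · rintro ⟨⟨y, hy, rfl⟩, k, hk⟩
      exact ⟨y, ⟨hy, k, T.subtype_injective (by simpa using hk)⟩, rfl⟩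
  refine ⟨fun x hx g => ?_⟩
  rw [hmem] at hx ⊢
  obtain ⟨h1, k, hk⟩ := hx
  exact ⟨hn.conj_mem x h1 g, k, by rw [conj_pow, hk]; simp⟩

theorem normal_residualIn_prime {T : Subgroup G}
    (h : ∀ p ∈ (Nat.card T).primeFactors,
      (residualIn (fun n => n = p ∨ n.Coprime p) T).Normal) :
    (residualIn Nat.Prime T).Normal := by
  rw [residualIn, chiefResidual_prime_eq_iSup]
  simp only [Subgroup.map_iSup]
  exact biSup_normal (↑(Nat.card T).primeFactors : Set ℕ)
    (fun p => residualIn (fun n => n = p ∨ n.Coprime p) T) h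

end SupersolvableResidual

theorem theorem3p13 {G : Type u} [Group G] [Finite G] [Group.IsSolvable G] (H : Subgroup G)
    [H.Normal] :
    (⨅ p ∈ (Nat.card H).primeFactors,
        weakNorm (fun (X : Type u) [Group X] => IsPSupersolvable p X) H) = ⊤ ↔
      weakNorm (fun (X : Type u) [Group X] => IsSupersolvable X) H = ⊤ := by
  -- `IsSupersolvable` unfolds to `ChiefOrders Nat.Prime`.
  have hU : weakNorm (fun (X : Type u) [Group X] => IsSupersolvable X) H = ⊤ ↔ _ :=
    weakNorm_eq_top_iff (P := Nat.Prime)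
  have hUp (p : ℕ) : weakNorm (fun (X : Type u) [Group X] => IsPSupersolvable p X) H = ⊤ ↔ _ :=
    weakNorm_eq_top_iff (P := fun n => n = p ∨ n.Coprime p)
  simp only [iInf_eq_top, hU, hUp]
  constructor
  · intro h T hT
    exact normal_residualIn_prime fun p hp => h p
      (Nat.primeFactors_mono (card_dvd_of_le hT) Nat.card_pos.ne' hp) T hT
  · intro h p hp T hT
    exact normal_residualIn_of_prime (isNilpotent_residualIn h hT) (h T hT)
      (Nat.prime_of_mem_primeFactors hp)
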